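/- Let $\psi=\Gamma'/\Gamma$ be the digamma function. The function $$\Phi(x)=\frac{1}{\psi\left(x+\frac12\right)-\ln x}-24x^{2}$$ is strictly increasing on $(0,\infty)$ and maps $(0,\infty)$ onto $(0,21/5)$. -/

import Mathlib

/-- The psi (digamma) function on the reals: the logarithmic derivative `Γ' / Γ` of the Gamma
function. -/
noncomputable def psi (x : ℝ) : ℝ := deriv Real.Gamma x / Real.Gamma x

/-- On the positive half-line, `psi` is Mathlib's complex digamma function. -/
theorem ofReal_psi {x : ℝ} (hx : 0 < x) : (psi x : ℂ) = Complex.digamma (x : ℂ) := by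
  have hd : DifferentiableAt ℂ Complex.Gamma (x : ℂ) := by
    refine Complex.differentiableAt_Gamma _ fun m h => ?_
    have h' : x = -(m : ℝ) := by exact_mod_cast h
    have hm : (0 : ℝ) ≤ m := Nat.cast_nonneg m
    linarith
  have h1 : HasDerivAt (fun y : ℝ => ((Real.Gamma y : ℝ) : ℂ)) (deriv Complex.Gamma x) x := by
    have h := hd.hasDerivAt.comp_ofReal
    simpa only [Complex.Gamma_ofReal] using h
  have hr : DifferentiableAt ℝ Real.Gamma x := Real.differentiableAt_Gamma fun m h => by
    have hm : (0 : ℝ) ≤ m := Nat.cast_nonneg m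
    linarith
  have h2 := h1.unique hr.hasDerivAt.ofReal_comp
  rw [Complex.digamma_def, logDeriv_apply, h2, Complex.Gamma_ofReal, psi, Complex.ofReal_div]

/-- The function `Φ(x) = 1 / (ψ(x + 1/2) - ln x) - 24 x²`. -/
noncomputable def Phi (x : ℝ) : ℝ := 1 / (psi (x + 1 / 2) - Real.log x) - 24 * x ^ 2

open Filter Topology Set

/-! Write r for `psiRemainder`. The functional equation of ψ makes r(x) - r(x+1) elementary with
rational derivative, and r → 0 at infinity, so r and r' are explicit series. Comparing first
derivatives, then unit differences, gives L ≤ r < U for rational L and U, where 1/L = 24x² + 21/5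
and 1/U - 24x² increases from 0 to 21/5. Since Φ' = -r'/r² - 48x, monotonicity means 48xr² < -r'. As
r < U, it suffices that 48xU² ≤ -r', which telescopes from `upperBound_sq_sub`. U also gives Φ > 0
and values near 21/5; L gives Φ < 21/5. Near 0, r blows up like -ln x, so Φ takes small values. -/

lemma nonneg_of_antitone_shift {f : ℝ → ℝ} (h : ∀ x, 0 < x → f (x + 1) ≤ f x)
    (hf : Tendsto f atTop (𝓝 0)) {x : ℝ} (hx : 0 < x) : 0 ≤ f x := by
  have hanti : Antitone fun n : ℕ => f (x + n) := antitone_nat_of_succ_le fun n => by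
    have := h (x + n) (by positivity)
    rwa [add_assoc, ← Nat.cast_succ] at this
  have hlim : Tendsto (fun n : ℕ => f (x + n)) atTop (𝓝 0) :=
    hf.comp (tendsto_atTop_add_const_left _ x tendsto_natCast_atTop_atTop)
  simpa using hanti.le_of_tendsto hlim 0

/-- Reduces inequalities involving logarithms to rational ones between derivatives. -/
lemma pos_of_deriv_neg {f f' : ℝ → ℝ} (hd : ∀ x, 0 < x → HasDerivAt f (f' x) x)
    (h : ∀ x, 0 < x → f' x < 0) (hf : Tendsto f atTop (𝓝 0)) {x : ℝ} (hx : 0 < x) : 0 < f x := by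
  have hanti : StrictAntiOn f (Ioi 0) := by
    refine strictAntiOn_of_deriv_neg (convex_Ioi 0)
      (fun y hy => (hd y hy).continuousAt.continuousWithinAt) fun y hy => ?_
    rw [interior_Ioi] at hy
    rw [(hd y hy).deriv]
    exact h y hy
  have hx1 : (0 : ℝ) < x + 1 := by linarith
  refine lt_of_le_of_lt ?_ (hanti hx hx1 (by linarith))
  refine le_of_tendsto hf ?_
  filter_upwards [eventually_ge_atTop (x + 1)] with y hy
  exact hanti.antitoneOn hx1 (lt_of_lt_of_le hx1 hy) hy

/-! ### The digamma function on the positive half-line -/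

lemma hasDerivAt_log_Gamma {x : ℝ} (hx : 0 < x) :
    HasDerivAt (Real.log ∘ Real.Gamma) (psi x) x := by
  have hr : DifferentiableAt ℝ Real.Gamma x := Real.differentiableAt_Gamma fun m h => by
    have hm : (0 : ℝ) ≤ m := Nat.cast_nonneg m
    linarith
  exact hr.hasDerivAt.log (Real.Gamma_pos_of_pos hx).ne'

lemma log_Gamma_add_one {x : ℝ} (hx : 0 < x) :
    (Real.log ∘ Real.Gamma) (x + 1) = (Real.log ∘ Real.Gamma) x + Real.log x := by
  simp only [Function.comp_apply, Real.Gamma_add_one hx.ne',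
    Real.log_mul hx.ne' (Real.Gamma_pos_of_pos hx).ne', add_comm]

lemma psi_add_one {x : ℝ} (hx : 0 < x) : psi (x + 1) = psi x + 1 / x := by
  have h1 : HasDerivAt (fun y => (Real.log ∘ Real.Gamma) (y + 1)) (psi (x + 1)) x :=
    (hasDerivAt_log_Gamma (by linarith : 0 < x + 1)).comp_add_const x 1
  have h2 : HasDerivAt (fun y => (Real.log ∘ Real.Gamma) y + Real.log y) (psi x + x⁻¹) x :=
    (hasDerivAt_log_Gamma hx).add (Real.hasDerivAt_log hx.ne')
  rw [one_div]
  refine h1.unique (h2.congr_of_eventuallyEq ?_)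
  filter_upwards [lt_mem_nhds hx] with y hy
  exact log_Gamma_add_one hy

/-- By convexity of log Γ, whose slope over [x, x+1] is ln x. -/
lemma psi_le_log {x : ℝ} (hx : 0 < x) : psi x ≤ Real.log x := by
  have := Real.convexOn_log_Gamma.le_slope_of_hasDerivAt (x := x) (y := x + 1) hx
    (show (0 : ℝ) < x + 1 by linarith) (by linarith) (hasDerivAt_log_Gamma hx)
  rw [slope_def_field, log_Gamma_add_one hx] at this
  simpa using this

lemma log_le_psi_add_one {x : ℝ} (hx : 0 < x) : Real.log x ≤ psi (x + 1) := by
  have hx1 : (0 : ℝ) < x + 1 := by linarith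
  have := Real.convexOn_log_Gamma.slope_le_of_hasDerivAt (x := x) (y := x + 1) hx
    hx1 (by linarith) (hasDerivAt_log_Gamma hx1)
  rw [slope_def_field, log_Gamma_add_one hx] at this
  simpa using this

/-! ### The remainder `ψ(x + 1/2) - ln x` and its differences -/

/-- The function `ψ(x + 1/2) - ln x`. -/
noncomputable def psiRemainder (x : ℝ) : ℝ := psi (x + 1 / 2) - Real.log x

/-- The difference `psiRemainder x - psiRemainder (x + 1)`. -/
noncomputable def psiStep (x : ℝ) : ℝ := Real.log (x + 1) - Real.log x - 1 / (x + 1 / 2)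

lemma psiRemainder_sub {x : ℝ} (hx : 0 < x) :
    psiRemainder x - psiRemainder (x + 1) = psiStep x := by
  have := psi_add_one (show 0 < x + 1 / 2 by linarith)
  rw [psiRemainder, psiRemainder, psiStep, show x + 1 + 1 / 2 = x + 1 / 2 + 1 by ring, this]
  ring

lemma abs_psiRemainder_le {x : ℝ} (hx : 1 / 2 < x) : |psiRemainder x| ≤ 1 / (x - 1 / 2) := by
  have hx0 : 0 < x := by linarith
  have hxm : 0 < x - 1 / 2 := by linarith
  have h1 := psi_le_log (show 0 < x + 1 / 2 by linarith)
  have h2 := log_le_psi_add_one hxm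
  rw [show x - 1 / 2 + 1 = x + 1 / 2 by ring] at h2
  have h3 := Real.log_le_sub_one_of_pos (show 0 < (x + 1 / 2) / x by positivity)
  have h4 := Real.log_le_sub_one_of_pos (show 0 < x / (x - 1 / 2) by positivity)
  rw [Real.log_div (by positivity) hx0.ne'] at h3
  rw [Real.log_div hx0.ne' hxm.ne'] at h4
  have h5 : (x + 1 / 2) / x - 1 ≤ 1 / (x - 1 / 2) := by
    rw [div_sub_one hx0.ne', div_le_div_iff₀ hx0 hxm]
    nlinarith
  have h6 : x / (x - 1 / 2) - 1 ≤ 1 / (x - 1 / 2) := by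
    rw [div_sub_one hxm.ne', div_le_div_iff₀ hxm hxm]
    nlinarith
  rw [abs_le, psiRemainder]
  constructor <;> linarith

lemma tendsto_psiRemainder : Tendsto psiRemainder atTop (𝓝 0) := by
  refine squeeze_zero_norm' (a := fun x : ℝ => 1 / (x - 1 / 2)) ?_ ?_
  · filter_upwards [eventually_gt_atTop (1 / 2 : ℝ)] with x hx
    exact abs_psiRemainder_le hx
  · simp only [one_div]
    exact tendsto_inv_atTop_zero.comp (tendsto_atTop_add_const_right _ _ tendsto_id)

/-- The derivative of `psiStep`, up to sign. -/
noncomputable def psiStepRate (x : ℝ) : ℝ := 1 / (x * (x + 1) * (2 * x + 1) ^ 2)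

lemma psiStepRate_pos {x : ℝ} (hx : 0 < x) : 0 < psiStepRate x := by
  unfold psiStepRate
  positivity

lemma hasDerivAt_psiStep {x : ℝ} (hx : 0 < x) : HasDerivAt psiStep (-psiStepRate x) x := by
  have hx1 : x + 1 ≠ 0 := by positivity
  have hx2 : x + 1 / 2 ≠ 0 := by positivity
  have h := ((((hasDerivAt_id x).add_const 1).log hx1).sub (Real.hasDerivAt_log hx.ne')).sub
    (((hasDerivAt_id x).add_const (1 / 2)).fun_inv hx2)
  convert! h using 1
  · ext y
    simp [psiStep]
  · simp only [psiStepRate, id]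
    have : 2 * x + 1 ≠ 0 := by positivity
    field_simp
    ring

lemma tendsto_psiStep : Tendsto psiStep atTop (𝓝 0) := by
  have h1 : Tendsto (fun x => psiRemainder (x + 1)) atTop (𝓝 0) :=
    tendsto_psiRemainder.comp (tendsto_atTop_add_const_right _ _ tendsto_id)
  have := tendsto_psiRemainder.sub h1
  rw [sub_zero] at this
  refine this.congr' ?_
  filter_upwards [eventually_gt_atTop 0] with x hx
  exact psiRemainder_sub hx

lemma psiStep_pos {x : ℝ} (hx : 0 < x) : 0 < psiStep x :=
  pos_of_deriv_neg (fun _ hy => hasDerivAt_psiStep hy)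
    (fun _ hy => neg_lt_zero.2 (psiStepRate_pos hy)) tendsto_psiStep hx

/-! ### Series for the remainder and its derivative -/

lemma tendsto_add_natCast (x : ℝ) : Tendsto (fun n : ℕ => x + n) atTop atTop :=
  tendsto_atTop_add_const_left _ x tendsto_natCast_atTop_atTop

lemma hasSum_sub_shift {f : ℝ → ℝ} (h : ∀ x, 0 < x → f (x + 1) ≤ f x)
    (hf : Tendsto f atTop (𝓝 0)) {x : ℝ} (hx : 0 < x) :
    HasSum (fun n : ℕ => f (x + n) - f (x + n + 1)) (f x) := by
  rw [hasSum_iff_tendsto_nat_of_nonneg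
    (fun n => sub_nonneg.2 (h _ (by positivity)))]
  have hsum (N : ℕ) : ∑ n ∈ Finset.range N, (f (x + n) - f (x + n + 1)) = f x - f (x + N) := by
    have := Finset.sum_range_sub' (fun n : ℕ => f (x + n)) N
    simpa [add_assoc] using this
  simp only [hsum]
  simpa using (hf.comp (tendsto_add_natCast x)).const_sub (f x)

lemma hasSum_psiStep {x : ℝ} (hx : 0 < x) :
    HasSum (fun n : ℕ => psiStep (x + n)) (psiRemainder x) := by
  have hstep (y : ℝ) (hy : 0 < y) : psiRemainder (y + 1) ≤ psiRemainder y := by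
    have := psiRemainder_sub hy
    have := psiStep_pos hy
    linarith
  refine (hasSum_sub_shift hstep tendsto_psiRemainder hx).congr_fun ?_
  intro n
  exact (psiRemainder_sub (by positivity)).symm

lemma psiStepRate_le {a x : ℝ} (ha : 0 < a) (hx : a < x) (n : ℕ) :
    psiStepRate (x + n) ≤ a⁻¹ * (1 / ((n : ℝ) + 1) ^ 2) := by
  have hn : (0 : ℝ) ≤ n := Nat.cast_nonneg n
  have hx0 : 0 < x := ha.trans hx
  rw [psiStepRate, ← one_div, one_div_mul_one_div]
  apply one_div_le_one_div_of_le (by positivity)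
  have h1 : a ≤ (x + n) * (x + n + 1) := by nlinarith [mul_nonneg hx0.le hn]
  have h2 : ((n : ℝ) + 1) ^ 2 ≤ (2 * (x + n) + 1) ^ 2 := by
    apply pow_le_pow_left₀ (by positivity)
    linarith
  gcongr

lemma summable_psiStepRate_bound (a : ℝ) :
    Summable fun n : ℕ => a⁻¹ * (1 / ((n : ℝ) + 1) ^ 2) := by
  have h : Summable fun n : ℕ => 1 / ((n : ℝ)) ^ 2 := Real.summable_one_div_nat_pow.2 one_lt_two
  have := (summable_nat_add_iff 1).2 h
  push_cast at this
  exact this.mul_left _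

lemma summable_psiStepRate {x : ℝ} (hx : 0 < x) : Summable fun n : ℕ => psiStepRate (x + n) :=
  Summable.of_nonneg_of_le (fun n => (psiStepRate_pos (by positivity)).le)
    (fun n => psiStepRate_le (half_pos hx) (half_lt_self hx) n) (summable_psiStepRate_bound _)

lemma hasDerivAt_psiRemainder {x : ℝ} (hx : 0 < x) :
    HasDerivAt psiRemainder (-∑' n : ℕ, psiStepRate (x + n)) x := by
  have ha : 0 < x / 2 := half_pos hx
  have h := hasDerivAt_tsum_of_isPreconnected (summable_psiStepRate_bound (x / 2))
    (isOpen_Ioi (a := x / 2)) isPreconnected_Ioi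
    (g := fun (n : ℕ) y => psiStep (y + n)) (g' := fun n y => -psiStepRate (y + n))
    (y₀ := x) (y := x)
    (fun n y hy => by
      have hy0 : 0 < y := ha.trans hy
      exact (hasDerivAt_psiStep (show 0 < y + n by positivity)).comp_add_const y n)
    (fun n y hy => by
      have hy0 : 0 < y := ha.trans hy
      rw [norm_neg, Real.norm_of_nonneg (psiStepRate_pos (by positivity)).le]
      exact psiStepRate_le ha hy n)
    (half_lt_self hx) (hasSum_psiStep hx).summable (half_lt_self hx)
  rw [tsum_neg] at h
  refine h.congr_of_eventuallyEq ?_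
  filter_upwards [lt_mem_nhds hx] with y hy
  exact (hasSum_psiStep hy).tsum_eq.symm

/-! ### Rational bounds -/

/-- A rational upper bound for `psiRemainder`. -/
noncomputable def upperBound (x : ℝ) : ℝ :=
  5 * (2 * x ^ 2 + 2 * x + 1) / (6 * x * (40 * x ^ 3 + 40 * x ^ 2 + 27 * x + 7))

/-- The derivative of `upperBound`, up to sign. -/
noncomputable def upperBoundRate (x : ℝ) : ℝ :=
  5 * (160 * x ^ 5 + 320 * x ^ 4 + 320 * x ^ 3 + 160 * x ^ 2 + 54 * x + 7) /
    (6 * (x * (40 * x ^ 3 + 40 * x ^ 2 + 27 * x + 7)) ^ 2)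

lemma hasDerivAt_upperBound {x : ℝ} (hx : 0 < x) :
    HasDerivAt upperBound (-upperBoundRate x) x := by
  have hD : 6 * x * (40 * x ^ 3 + 40 * x ^ 2 + 27 * x + 7) ≠ 0 := by positivity
  have hid := hasDerivAt_id x
  have hnum : HasDerivAt (fun y : ℝ => 5 * (2 * y ^ 2 + 2 * y + 1)) (5 * (4 * x + 2)) x := by
    convert! ((((hid.pow 2).const_mul 2).add (hid.const_mul 2)).add_const 1).const_mul 5 using 1
    simp
    ring
  have hden : HasDerivAt (fun y : ℝ => 6 * y * (40 * y ^ 3 + 40 * y ^ 2 + 27 * y + 7))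
      (960 * x ^ 3 + 720 * x ^ 2 + 324 * x + 42) x := by
    convert! (hid.const_mul 6).mul
      (((((hid.pow 3).const_mul 40).add ((hid.pow 2).const_mul 40)).add
        (hid.const_mul 27)).add_const 7) using 1
    simp
    ring
  convert! hnum.div hden hD using 1
  rw [upperBoundRate]
  have : 40 * x ^ 3 + 40 * x ^ 2 + 27 * x + 7 ≠ 0 := by positivity
  field_simp
  ring

/-- The reciprocal of `upperBound`. -/
lemma one_div_upperBound {x : ℝ} (hx : 0 < x) :
    1 / upperBound x = 24 * x ^ 2 + 21 / 5 - 21 / (5 * (2 * x ^ 2 + 2 * x + 1)) := by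
  rw [upperBound]
  have : 40 * x ^ 3 + 40 * x ^ 2 + 27 * x + 7 ≠ 0 := by positivity
  have : 2 * x ^ 2 + 2 * x + 1 ≠ 0 := by positivity
  field_simp
  ring

lemma upperBound_pos {x : ℝ} (hx : 0 < x) : 0 < upperBound x := by
  unfold upperBound
  positivity

lemma upperBoundRate_sub {x : ℝ} (hx : 0 < x) :
    upperBoundRate (x + 1) + psiStepRate x < upperBoundRate x := by
  unfold upperBoundRate psiStepRate
  rw [div_add_div _ _ (by positivity) (by positivity), div_lt_div_iff₀ (by positivity)
    (by positivity), ← sub_pos]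
  -- The expanded difference of cross products has only positive coefficients; the later uses of
  -- `ring_nf` before `positivity` work likewise.
  ring_nf
  positivity

lemma upperBound_sq_sub {x : ℝ} (hx : 0 < x) :
    48 * x * upperBound x ^ 2 ≤ psiStepRate x + 48 * (x + 1) * upperBound (x + 1) ^ 2 := by
  have h (y : ℝ) (hy : 0 < y) : 48 * y * upperBound y ^ 2 =
      100 * (2 * y ^ 2 + 2 * y + 1) ^ 2 /
        (3 * y * (40 * y ^ 3 + 40 * y ^ 2 + 27 * y + 7) ^ 2) := by
    rw [upperBound]
    have : 40 * y ^ 3 + 40 * y ^ 2 + 27 * y + 7 ≠ 0 := by positivity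
    field_simp
    ring
  rw [h x hx, h (x + 1) (by positivity), psiStepRate,
    div_add_div _ _ (by positivity) (by positivity), div_le_div_iff₀ (by positivity)
    (by positivity), ← sub_nonneg]
  ring_nf
  positivity

/-- A rational lower bound for `psiRemainder`. -/
noncomputable def lowerBound (x : ℝ) : ℝ := 5 / (120 * x ^ 2 + 21)

/-- The derivative of `lowerBound`, up to sign. -/
noncomputable def lowerBoundRate (x : ℝ) : ℝ := 1200 * x / (120 * x ^ 2 + 21) ^ 2

lemma hasDerivAt_lowerBound {x : ℝ} : HasDerivAt lowerBound (-lowerBoundRate x) x := by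
  have hden : HasDerivAt (fun y : ℝ => 120 * y ^ 2 + 21) (240 * x) x := by
    convert! (((hasDerivAt_id x).pow 2).const_mul 120).add_const 21 using 1
    simp
    ring
  convert! (hasDerivAt_const x (5 : ℝ)).div hden (by positivity) using 1
  rw [lowerBoundRate]
  ring

lemma lowerBoundRate_sub {x : ℝ} (hx : 0 < x) :
    lowerBoundRate x < psiStepRate x + lowerBoundRate (x + 1) := by
  unfold lowerBoundRate psiStepRate
  rw [div_add_div _ _ (by positivity) (by positivity), div_lt_div_iff₀ (by positivity)
    (by positivity), ← sub_pos]
  ring_nf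
  positivity

lemma tendsto_lowerBound : Tendsto lowerBound atTop (𝓝 0) := by
  refine squeeze_zero' (g := fun x : ℝ => 5 * x⁻¹) (Eventually.of_forall fun x => ?_) ?_ ?_
  · unfold lowerBound
    positivity
  · filter_upwards [eventually_gt_atTop (0 : ℝ)] with x hx
    rw [lowerBound, ← div_eq_mul_inv, div_le_div_iff₀ (by positivity) hx]
    nlinarith [sq_nonneg (x - 1)]
  · simpa using tendsto_inv_atTop_zero.const_mul (5 : ℝ)

lemma upperBound_le_inv {x : ℝ} (hx : 0 < x) : upperBound x ≤ 5 * x⁻¹ := by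
  rw [upperBound, ← div_eq_mul_inv, div_le_div_iff₀ (by positivity) hx, ← sub_nonneg]
  ring_nf
  positivity

lemma tendsto_upperBound : Tendsto upperBound atTop (𝓝 0) := by
  refine squeeze_zero' (g := fun x : ℝ => 5 * x⁻¹) ?_ ?_ ?_
  · filter_upwards [eventually_gt_atTop (0 : ℝ)] with x hx
    exact (upperBound_pos hx).le
  · filter_upwards [eventually_gt_atTop (0 : ℝ)] with x hx
    exact upperBound_le_inv hx
  · simpa using tendsto_inv_atTop_zero.const_mul (5 : ℝ)

/-! ### Comparing the remainder with the bounds -/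

lemma tendsto_comp_add_one {f : ℝ → ℝ} (hf : Tendsto f atTop (𝓝 0)) :
    Tendsto (fun x => f (x + 1)) atTop (𝓝 0) :=
  hf.comp (tendsto_atTop_add_const_right _ _ tendsto_id)

lemma psiStep_lt_upperBound_sub {x : ℝ} (hx : 0 < x) :
    psiStep x < upperBound x - upperBound (x + 1) := by
  have h := pos_of_deriv_neg (f := fun y => upperBound y - upperBound (y + 1) - psiStep y)
    (fun y hy => ((hasDerivAt_upperBound hy).sub
      ((hasDerivAt_upperBound (by linarith : 0 < y + 1)).comp_add_const y 1)).sub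
        (hasDerivAt_psiStep hy))
    (fun y hy => by linarith [upperBoundRate_sub hy])
    (by simpa using
      (tendsto_upperBound.sub (tendsto_comp_add_one tendsto_upperBound)).sub tendsto_psiStep) hx
  exact sub_pos.1 h

lemma lowerBound_sub_lt_psiStep {x : ℝ} (hx : 0 < x) :
    lowerBound x - lowerBound (x + 1) < psiStep x := by
  have h := pos_of_deriv_neg (f := fun y => psiStep y - (lowerBound y - lowerBound (y + 1)))
    (fun y hy => (hasDerivAt_psiStep hy).sub
      (hasDerivAt_lowerBound.sub (hasDerivAt_lowerBound.comp_add_const y 1)))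
    (fun y hy => by linarith [lowerBoundRate_sub hy])
    (by simpa using
      tendsto_psiStep.sub (tendsto_lowerBound.sub (tendsto_comp_add_one tendsto_lowerBound))) hx
  exact sub_pos.1 h

lemma psiRemainder_lt_upperBound {x : ℝ} (hx : 0 < x) : psiRemainder x < upperBound x := by
  have hlt (y : ℝ) (hy : 0 < y) :
      upperBound (y + 1) - psiRemainder (y + 1) < upperBound y - psiRemainder y := by
    linarith [psiStep_lt_upperBound_sub hy, psiRemainder_sub hy]
  -- The limit yields only ≤, so it is applied at x + 1; the strict step from x to x + 1 restores <.
  have h := nonneg_of_antitone_shift (fun y hy => (hlt y hy).le)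
    (by simpa using tendsto_upperBound.sub tendsto_psiRemainder) (show 0 < x + 1 by linarith)
  linarith [hlt x hx]

lemma lowerBound_le_psiRemainder {x : ℝ} (hx : 0 < x) : lowerBound x ≤ psiRemainder x := by
  have h := nonneg_of_antitone_shift (f := fun y => psiRemainder y - lowerBound y)
    (fun y hy => by linarith [lowerBound_sub_lt_psiStep hy, psiRemainder_sub hy])
    (by simpa using tendsto_psiRemainder.sub tendsto_lowerBound) hx
  exact sub_nonneg.1 h

lemma psiRemainder_pos {x : ℝ} (hx : 0 < x) : 0 < psiRemainder x :=
  lt_of_lt_of_le (by unfold lowerBound; positivity) (lowerBound_le_psiRemainder hx)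

/-- Telescoping `upperBound_sq_sub`; the tail term is O(1/(x+N)). -/
lemma upperBound_sq_le_tsum {x : ℝ} (hx : 0 < x) :
    48 * x * upperBound x ^ 2 ≤ ∑' n : ℕ, psiStepRate (x + n) := by
  have hlim : Tendsto (fun N : ℕ => 48 * (x + N) * upperBound (x + N) ^ 2) atTop (𝓝 0) := by
    refine squeeze_zero (g := fun N : ℕ => 1200 * (x + N)⁻¹) (fun N => by positivity)
      (fun N => ?_) ?_
    · have hy : 0 < x + N := by positivity
      have := pow_le_pow_left₀ (upperBound_pos hy).le (upperBound_le_inv hy) 2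
      calc 48 * (x + N) * upperBound (x + N) ^ 2 ≤ 48 * (x + N) * (5 * (x + N)⁻¹) ^ 2 := by gcongr
        _ = 1200 * (x + N)⁻¹ := by field_simp; norm_num
    · simpa using (tendsto_inv_atTop_zero.comp (tendsto_add_natCast x)).const_mul (1200 : ℝ)
  have hsum (N : ℕ) : 48 * x * upperBound x ^ 2 - 48 * (x + N) * upperBound (x + N) ^ 2 ≤
      ∑' n : ℕ, psiStepRate (x + n) := by
    refine le_trans ?_ ((summable_psiStepRate hx).sum_le_tsum (Finset.range N)
      fun n _ => (psiStepRate_pos (by positivity)).le)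
    induction N with
    | zero => simp
    | succ N ih =>
      have := upperBound_sq_sub (show 0 < x + N by positivity)
      rw [Finset.sum_range_succ]
      push_cast
      rw [← add_assoc]
      linarith
  simpa using le_of_tendsto' (hlim.const_sub (48 * x * upperBound x ^ 2)) hsum

/-! ### The function `Phi` -/

lemma Phi_eq (x : ℝ) : Phi x = 1 / psiRemainder x - 24 * x ^ 2 := rfl

lemma hasDerivAt_Phi {x : ℝ} (hx : 0 < x) :
    HasDerivAt Phi ((∑' n : ℕ, psiStepRate (x + n)) / psiRemainder x ^ 2 - 48 * x) x := by
  have h1 := (hasDerivAt_psiRemainder hx).fun_inv (psiRemainder_pos hx).ne'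
  have h2 : HasDerivAt (fun y : ℝ => 24 * y ^ 2) (48 * x) x := by
    convert! ((hasDerivAt_id x).pow 2).const_mul 24 using 1
    simp
    ring
  convert! h1.sub h2 using 1
  · ext y
    simp [Phi_eq]
  · rw [neg_neg]

lemma strictMonoOn_Phi : StrictMonoOn Phi (Ioi 0) := by
  refine strictMonoOn_of_deriv_pos (convex_Ioi 0)
    (fun y hy => (hasDerivAt_Phi hy).continuousAt.continuousWithinAt) fun x hx => ?_
  rw [interior_Ioi] at hx
  have hx0 : 0 < x := hx
  have hpos := psiRemainder_pos hx0
  rw [(hasDerivAt_Phi hx0).deriv, sub_pos, lt_div_iff₀ (by positivity)]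
  refine lt_of_lt_of_le ?_ (upperBound_sq_le_tsum hx0)
  have := pow_lt_pow_left₀ (psiRemainder_lt_upperBound hx0) hpos.le two_ne_zero
  gcongr

lemma lt_Phi {x : ℝ} (hx : 0 < x) : 21 / 5 - 21 / (5 * (2 * x ^ 2 + 2 * x + 1)) < Phi x := by
  have := one_div_lt_one_div_of_lt (psiRemainder_pos hx) (psiRemainder_lt_upperBound hx)
  rw [one_div_upperBound hx] at this
  rw [Phi_eq]
  linarith

lemma Phi_pos {x : ℝ} (hx : 0 < x) : 0 < Phi x := by
  refine lt_trans ?_ (lt_Phi hx)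
  rw [sub_pos, div_lt_div_iff₀ (by positivity) (by positivity)]
  nlinarith [sq_nonneg x]

lemma Phi_lt {x : ℝ} (hx : 0 < x) : Phi x < 21 / 5 := by
  have hx1 : 0 < x + 1 := by linarith
  -- The lower bound gives only ≤ 21/5; strictness comes from moving to x + 1.
  refine lt_of_lt_of_le (strictMonoOn_Phi hx hx1 (by linarith)) ?_
  have h := one_div_le_one_div_of_le (by unfold lowerBound; positivity)
    (lowerBound_le_psiRemainder hx1)
  rw [lowerBound, one_div_div] at h
  rw [Phi_eq]
  linarith

lemma exists_Phi_lt {c : ℝ} (hc : 0 < c) : ∃ x, 0 < x ∧ Phi x < c := by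
  have hx := Real.exp_pos (-(2 + 1 / c))
  -- Here -ln x = 2 + 1/c: the 2 absorbs 1/(x + 1/2), leaving r(x) > 1/c.
  refine ⟨_, hx, ?_⟩
  set x := Real.exp (-(2 + 1 / c)) with hxdef
  have hlog : Real.log x = -(2 + 1 / c) := Real.log_exp _
  have h1 : 0 < Real.log (x + 1) := Real.log_pos (by linarith)
  have h2 : 1 / (x + 1 / 2) < 2 := by
    rw [div_lt_iff₀ (by positivity)]
    linarith
  have h3 := psiRemainder_sub hx
  have h4 := psiRemainder_pos (show 0 < x + 1 by linarith)
  rw [psiStep, hlog] at h3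
  have h5 : 1 / c < psiRemainder x := by linarith
  have h6 := one_div_lt_one_div_of_lt (by positivity) h5
  rw [one_div_one_div] at h6
  rw [Phi_eq]
  linarith [sq_nonneg x]

lemma exists_lt_Phi {c : ℝ} (hc : c < 21 / 5) : ∃ x, 0 < x ∧ c < Phi x := by
  have hd : 0 < 21 / 5 - c := by linarith
  have hx : 0 < 21 / (21 / 5 - c) := by positivity
  -- The witness makes 21/x equal the gap 21/5 - c, and 21/x dominates the error term in `lt_Phi`.
  refine ⟨_, hx, lt_of_le_of_lt ?_ (lt_Phi hx)⟩
  set x := 21 / (21 / 5 - c) with hxdef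
  have h1 : 21 / x = 21 / 5 - c := by
    rw [hxdef]
    field_simp
  have h2 : 21 / (5 * (2 * x ^ 2 + 2 * x + 1)) ≤ 21 / x := by
    apply div_le_div_of_nonneg_left (by norm_num) hx
    nlinarith [sq_nonneg x]
  linarith

theorem mainTheorem5 :
    StrictMonoOn Phi (Set.Ioi (0 : ℝ)) ∧
      Phi '' Set.Ioi (0 : ℝ) = Set.Ioo (0 : ℝ) (21 / 5) := by
  refine ⟨strictMonoOn_Phi, Set.Subset.antisymm ?_ ?_⟩
  · rintro _ ⟨x, hx, rfl⟩
    exact ⟨Phi_pos hx, Phi_lt hx⟩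
  · rintro c ⟨hc0, hc1⟩
    obtain ⟨a, ha, hac⟩ := exists_Phi_lt hc0
    obtain ⟨b, hb, hbc⟩ := exists_lt_Phi hc1
    exact isPreconnected_Ioi.intermediate_value ha hb
      (fun y hy => (hasDerivAt_Phi hy).continuousAt.continuousWithinAt) ⟨hac.le, hbc.le⟩
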